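/- Let $\ell \ge 1$ and $r$ be integers, and let $X$ be a germ at $0$ of a $C^{\ell+r}$ vector field on the real line (identified with its coefficient function). Suppose that $X$ is expanding, i.e. $X(x)>0$ for all small enough $x>0$, and exactly $\ell$-flat, i.e. $X(x)=\alpha x^{\ell+1}+o(x^{\ell+1})$ as $x\to 0$ for some $\alpha\neq 0$. Suppose also that either $r\ge \ell+2$, or $r=\ell+1$ and $X$ is $(2\ell+2)$ times differentiable at $0$. Then there is a unique $\mu\in\mathbb{R}$ such that $X$ is $C^r$ conjugate to the vector field $X_\mu(x)=x^{\ell+1}+\mu x^{2\ell+1}$. That is: there is a germ $h$ of an orientation-preserving $C^r$ diffeomorphism of the real line fixing $0$ such that $h'(x)\,X(x)=X_\mu(h(x))$ for all $x$ near $0$; and if $h$ is any germ of a $C^r$ diffeomorphism of the real line fixing $0$ (orientation-preserving or not) with $h'(x)\,X(x)=X_\nu(h(x))$ for all $x$ near $0$, then $\nu=\mu$. -/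

import Mathlib

open Filter Topology Asymptotics

namespace FlatVectorField

/-- A germ at `0` of vector field `X(x) ∂ₓ` on the real line is represented by its coefficient
function `X : ℝ → ℝ`. It is *expanding* if `X x > 0` for all small enough `x > 0`. -/
def Expanding (X : ℝ → ℝ) : Prop :=
  ∀ᶠ x in 𝓝[>] (0 : ℝ), 0 < X x

/-- `X` is *exactly `ℓ`-flat*: `X x = α x ^ (ℓ + 1) + o(x ^ (ℓ + 1))` at `0` with `α ≠ 0`. -/
def ExactlyFlat (ℓ : ℕ) (X : ℝ → ℝ) : Prop :=
  ∃ α : ℝ, α ≠ 0 ∧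
    (fun x : ℝ => X x - α * x ^ (ℓ + 1)) =o[𝓝 0] fun x : ℝ => x ^ (ℓ + 1)

/-- `f` is `n` times differentiable at the point `a`: the derivatives of order `< n - 1` are
differentiable on a neighbourhood of `a`, and the derivative of order `n - 1` is differentiable
at `a` itself. -/
def TimesDifferentiableAt (n : ℕ) (f : ℝ → ℝ) (a : ℝ) : Prop :=
  ∀ k < n, DifferentiableAt ℝ (iteratedDeriv k f) a ∧
    (k + 1 < n → ∀ᶠ x in 𝓝 a, DifferentiableAt ℝ (iteratedDeriv k f) x)

/-- `h` represents a germ of `C^r` diffeomorphism of the real line fixing the origin: it is of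
class `C^r` near `0`, fixes `0`, and has an inverse germ with the same properties. -/
def IsDiffeoGerm (r : ℕ) (h : ℝ → ℝ) : Prop :=
  ContDiffAt ℝ r h 0 ∧ h 0 = 0 ∧
    ∃ g : ℝ → ℝ, ContDiffAt ℝ r g 0 ∧ g 0 = 0 ∧
      (∀ᶠ x in 𝓝 (0 : ℝ), g (h x) = x) ∧ (∀ᶠ x in 𝓝 (0 : ℝ), h (g x) = x)

/-- `h` sends the germ of vector field `X` to the germ `Y`, i.e. `h_* X = Y` near `0`. -/
def Conjugates (h X Y : ℝ → ℝ) : Prop :=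
  ∀ᶠ x in 𝓝 (0 : ℝ), deriv h x * X x = Y (h x)

/-- The vector field `x ↦ x ^ (ℓ + 1) + μ x ^ (2 ℓ + 1)`. -/
def normalForm (ℓ : ℕ) (μ : ℝ) (x : ℝ) : ℝ :=
  x ^ (ℓ + 1) + μ * x ^ (2 * ℓ + 1)

end FlatVectorField

open Filter Topology Asymptotics

namespace FlatVectorField

/-! A conjugacy matches time functions, i.e. primitives of `1/X`. Put `n = r - 1`, `X = x^(ℓ+1) Y`
and `Z = 1/Y` near `0`; both factors are `C^n`. For `x > 0` the time of `X` is `-G/(ℓ x^ℓ) - μ log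
x`, where `ℓ G - x G' = ℓ (Z + μ x^ℓ)`. The Euler operator on the left kills `x^ℓ`, so this monomial
is an obstruction and `μ` must absorb it (`exists_euler_solution`). A `C^n` solution is obtained
once the `ℓ`-th derivative of `Z` is differentiable at `0`, which both alternatives on `r`
guarantee.

The time of the normal form is `-1/(ℓ y^ℓ) - μ log y + (μ/ℓ) log(1 + μ y^ℓ)`. Equating the two at `y
= x k(x)` and multiplying by `-ℓ x^ℓ` cancels `log x`; the implicit function theorem then gives a
`C^n` function `k` (`exists_time_solution`). The differential equation expresses the derivative of
`h = x k` through `C^n` functions, so `h` is `C^r`.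

For uniqueness, `k^(-ℓ)` solves the Euler equation with `ν` up to `o(x^ℓ)`. Subtracting from `G`
leaves a term `ℓ (μ - ν) x^ℓ`, which the operator cannot produce (`euler_operator_coeff_eq_zero`).
-/

/-- A germ of class `C^n` extends to a function of class `C^n` on the whole line. -/
theorem exists_contDiff_eventuallyEq {n : ℕ} {f : ℝ → ℝ} {a : ℝ} (hf : ContDiffAt ℝ n f a) :
    ∃ F : ℝ → ℝ, ContDiff ℝ n F ∧ F =ᶠ[𝓝 a] f := by
  obtain ⟨u, hu, hfu⟩ := hf.contDiffOn le_rfl (by simp)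
  obtain ⟨ε, hε, hεu⟩ := Metric.mem_nhds_iff.1 hu
  let b : ContDiffBump a := ⟨ε / 4, ε / 2, by positivity, by linarith⟩
  refine ⟨fun x => b x * f x, ?_, ?_⟩
  · rw [contDiff_iff_contDiffAt]
    intro x
    by_cases hx : x ∈ Metric.ball a ε
    · exact b.contDiff.contDiffAt.mul
        ((hfu.mono hεu).contDiffAt (Metric.isOpen_ball.mem_nhds hx))
    · have hx' : x ∈ (Metric.closedBall a (ε / 2))ᶜ := by
        simp only [Metric.mem_ball, not_lt, Set.mem_compl_iff, Metric.mem_closedBall,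
          not_le] at hx ⊢
        linarith
      refine (contDiffAt_const (c := (0 : ℝ))).congr_of_eventuallyEq ?_
      filter_upwards [Metric.isClosed_closedBall.isOpen_compl.mem_nhds hx'] with y hy
      have : b y = 0 := b.zero_of_le_dist (by
        simp only [Set.mem_compl_iff, Metric.mem_closedBall, not_le] at hy
        exact hy.le)
      simp [this]
  · filter_upwards [b.eventuallyEq_one] with x hx
    simp [hx]

/-! ### Hadamard division and differentiability at the origin -/

/-- The weighted mean of `f` over the segment joining `0` and `x`. -/
noncomputable def dilationMean (p : ℕ) (f : ℝ → ℝ) (x : ℝ) : ℝ :=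
  ∫ s in (0 : ℝ)..1, s ^ p * f (s * x)

theorem continuous_dilationMean (p : ℕ) {f : ℝ → ℝ} (hf : Continuous f) :
    Continuous (dilationMean p f) := by
  unfold dilationMean
  apply intervalIntegral.continuous_parametric_intervalIntegral_of_continuous'
  fun_prop

theorem hasDerivAt_dilationMean (p : ℕ) {f : ℝ → ℝ} (hf : ContDiff ℝ 1 f) (x : ℝ) :
    HasDerivAt (dilationMean p f) (dilationMean (p + 1) (deriv f) x) x := by
  have hc : Continuous f := hf.continuous
  have hc' : Continuous (deriv f) := hf.continuous_deriv_one
  obtain ⟨C, hC⟩ := (isCompact_closedBall (0 : ℝ) (|x| + 1)).exists_bound_of_continuousOn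
    hc'.continuousOn
  refine (intervalIntegral.hasDerivAt_integral_of_dominated_loc_of_deriv_le
    (F := fun x s => s ^ p * f (s * x)) (F' := fun x s => s ^ (p + 1) * deriv f (s * x))
    (bound := fun _ => C) (Metric.ball_mem_nhds x one_pos)
    (Eventually.of_forall fun y => ?_) ?_ ?_ ?_ ?_ ?_).2
  · exact (by fun_prop : Continuous fun s => s ^ p * f (s * y)).aestronglyMeasurable
  · exact (by fun_prop : Continuous fun s => s ^ p * f (s * x)).intervalIntegrable _ _
  · exact (by fun_prop : Continuous fun s => s ^ (p + 1) * deriv f (s * x)).aestronglyMeasurable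
  · refine Eventually.of_forall fun s hs y hy => ?_
    rw [Set.uIoc_of_le zero_le_one] at hs
    have hy' : |y| ≤ |x| + 1 := by
      have h1 : |y - x| < 1 := by simpa [Real.dist_eq] using hy
      have h2 := abs_sub_abs_le_abs_sub y x
      linarith
    have hsy : s * y ∈ Metric.closedBall (0 : ℝ) (|x| + 1) := by
      rw [mem_closedBall_zero_iff, Real.norm_eq_abs, abs_mul, abs_of_pos hs.1]
      nlinarith [hs.1, hs.2, abs_nonneg y]
    have hpow : ‖s ^ (p + 1)‖ ≤ 1 := by
      rw [Real.norm_eq_abs, abs_of_nonneg (pow_nonneg hs.1.le _)]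
      exact pow_le_one₀ hs.1.le hs.2
    rw [norm_mul]
    calc _ ≤ 1 * C := mul_le_mul hpow (hC _ hsy) (norm_nonneg _) zero_le_one
      _ = C := one_mul C
  · exact intervalIntegrable_const
  · refine Eventually.of_forall fun s _ y _ => ?_
    have h1 : HasDerivAt f (deriv f (s * y)) (s * y) :=
      (hf.differentiable one_ne_zero _).hasDerivAt
    have h2 : HasDerivAt (fun y : ℝ => s * y) s y := by
      simpa using (hasDerivAt_id y).const_mul s
    refine ((h1.comp y h2).const_mul (s ^ p)).congr_deriv ?_
    ring

theorem contDiff_dilationMean {n : ℕ} (p : ℕ) {f : ℝ → ℝ} (hf : ContDiff ℝ n f) :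
    ContDiff ℝ n (dilationMean p f) := by
  induction n generalizing p f with
  | zero =>
    exact contDiff_zero.2 (continuous_dilationMean p (contDiff_zero.1 hf))
  | succ n ih =>
    have h1 : ContDiff ℝ 1 f := hf.of_le (by norm_cast; omega)
    have hd := hasDerivAt_dilationMean p h1
    push_cast at hf ⊢
    rw [contDiff_succ_iff_deriv] at hf ⊢
    refine ⟨fun x => (hd x).differentiableAt, by simp, ?_⟩
    rw [funext fun x => (hd x).deriv]
    exact ih _ hf.2.2

/-- Derivatives of means are again means, so differentiability of a top derivative at the single
point `0` passes through division by `x`. -/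
theorem iteratedDeriv_dilationMean {n : ℕ} (p : ℕ) {f : ℝ → ℝ} (hf : ContDiff ℝ n f) :
    iteratedDeriv n (dilationMean p f) = dilationMean (p + n) (iteratedDeriv n f) := by
  induction n generalizing p f with
  | zero => simp
  | succ n ih =>
    have h1 : ContDiff ℝ 1 f := hf.of_le (by norm_cast; omega)
    rw [iteratedDeriv_succ', iteratedDeriv_succ',
      funext fun x => (hasDerivAt_dilationMean p h1 x).deriv,
      ih (p + 1) (by push_cast at hf; exact (contDiff_succ_iff_deriv.1 hf).2.2)]
    congr 1
    ring

theorem eq_add_mul_dslope (f : ℝ → ℝ) (x : ℝ) : f x = f 0 + x * dslope f 0 x := by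
  have := sub_smul_dslope f 0 x
  simp only [sub_zero, smul_eq_mul] at this
  linarith

theorem continuous_dslope_zero {f : ℝ → ℝ} (hf : Continuous f) (hd : DifferentiableAt ℝ f 0) :
    Continuous (dslope f 0) := by
  rw [← continuousOn_univ, continuousOn_dslope univ_mem]
  exact ⟨hf.continuousOn, hd⟩

theorem differentiableAt_id_mul {c : ℝ → ℝ} (hc : ContinuousAt c 0) :
    DifferentiableAt ℝ (fun x => x * c x) 0 := by
  have : HasDerivAt (fun x => x * c x) (c 0) 0 := by
    rw [hasDerivAt_iff_tendsto_slope_zero]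
    refine (hc.tendsto.mono_left nhdsWithin_le_nhds).congr' ?_
    filter_upwards [self_mem_nhdsWithin] with t ht
    have : t ≠ 0 := ht
    simp [this]
  exact this.differentiableAt

/-- Expanding `f (s x)` around `0` gives a constant plus `x` times a continuous function;
differentiability of `f` away from `0` plays no role. -/
theorem differentiableAt_dilationMean (p : ℕ) {f : ℝ → ℝ} (hf : Continuous f)
    (hd : DifferentiableAt ℝ f 0) : DifferentiableAt ℝ (dilationMean p f) 0 := by
  have hc := continuous_dslope_zero hf hd
  have key : dilationMean p f =
      fun x => (∫ s in (0 : ℝ)..1, s ^ p * f 0) + x * dilationMean (p + 1) (dslope f 0) x := by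
    funext x
    unfold dilationMean
    rw [← intervalIntegral.integral_const_mul, ← intervalIntegral.integral_add]
    · refine intervalIntegral.integral_congr fun s _ => ?_
      rw [eq_add_mul_dslope f (s * x)]
      ring
    · exact (by fun_prop : Continuous fun s : ℝ => s ^ p * f 0).intervalIntegrable _ _
    · exact (by fun_prop : Continuous fun s : ℝ =>
        x * (s ^ (p + 1) * dslope f 0 (s * x))).intervalIntegrable _ _
  rw [key]
  exact (differentiableAt_const _).add
    (differentiableAt_id_mul (continuous_dilationMean _ hc).continuousAt)

theorem dslope_eq_dilationMean {f : ℝ → ℝ} (hf : ContDiff ℝ 1 f) :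
    dslope f 0 = dilationMean 0 (deriv f) := by
  have hc' : Continuous (deriv f) := hf.continuous_deriv_one
  funext x
  rcases eq_or_ne x 0 with rfl | hx
  · simp [dilationMean]
  · rw [dslope_of_ne _ hx, slope_def_field, div_eq_iff (sub_ne_zero.2 hx)]
    have h := intervalIntegral.integral_eq_sub_of_hasDerivAt (a := (0 : ℝ)) (b := 1)
      (f := fun s => f (s * x)) (f' := fun s => deriv f (s * x) * x)
      (fun s _ => by
        have h2 : HasDerivAt (fun s : ℝ => s * x) x s := by
          simpa using (hasDerivAt_id s).mul_const x
        exact ((hf.differentiable one_ne_zero _).hasDerivAt.comp s h2))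
      ((by fun_prop : Continuous fun s : ℝ => deriv f (s * x) * x).intervalIntegrable _ _)
    rw [intervalIntegral.integral_mul_const] at h
    simpa [dilationMean] using h.symm

/-- **Hadamard's lemma** in finite regularity. -/
theorem contDiff_dslope_zero {n : ℕ} {f : ℝ → ℝ} (hf : ContDiff ℝ (n + 1 : ℕ) f) :
    ContDiff ℝ n (dslope f 0) := by
  rw [dslope_eq_dilationMean (hf.of_le (by norm_cast; omega))]
  push_cast at hf
  exact contDiff_dilationMean 0 (contDiff_succ_iff_deriv.1 hf).2.2

theorem differentiableAt_iteratedDeriv_dslope {n : ℕ} {f : ℝ → ℝ}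
    (hf : ContDiff ℝ (n + 1 : ℕ) f) (hd : DifferentiableAt ℝ (iteratedDeriv (n + 1) f) 0) :
    DifferentiableAt ℝ (iteratedDeriv n (dslope f 0)) 0 := by
  rw [dslope_eq_dilationMean (hf.of_le (by norm_cast; omega))]
  push_cast at hf
  have hf' := (contDiff_succ_iff_deriv.1 hf).2.2
  rw [iteratedDeriv_dilationMean 0 hf']
  rw [iteratedDeriv_succ'] at hd
  exact differentiableAt_dilationMean _ (hf'.continuous_iteratedDeriv n le_rfl) hd

/-- Division of a flat function by the monomial of its leading term. -/
theorem exists_eq_pow_mul {m n : ℕ} {f : ℝ → ℝ} {α : ℝ} (hf : ContDiff ℝ (m + n : ℕ) f)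
    (hα : (fun x : ℝ => f x - α * x ^ m) =o[𝓝[≠] 0] fun x : ℝ => x ^ m) :
    ∃ g : ℝ → ℝ, ContDiff ℝ n g ∧ g 0 = α ∧ (∀ x, f x = x ^ m * g x) ∧
      (DifferentiableAt ℝ (iteratedDeriv (m + n) f) 0 →
        DifferentiableAt ℝ (iteratedDeriv n g) 0) := by
  induction m generalizing f with
  | zero =>
    simp only [Nat.zero_add] at hf ⊢
    refine ⟨f, hf, ?_, by simp, id⟩
    have h1 : Tendsto (fun x => f x - α) (𝓝[≠] 0) (𝓝 0) := by
      simpa [isLittleO_one_iff] using hα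
    have h2 : Tendsto (fun x => f x - α) (𝓝[≠] 0) (𝓝 (f 0 - α)) :=
      (hf.continuous.continuousAt.tendsto.sub_const α).mono_left nhdsWithin_le_nhds
    exact sub_eq_zero.1 (tendsto_nhds_unique h2 h1)
  | succ m ih =>
    have hc : ContinuousAt f 0 := hf.continuous.continuousAt
    have hpow : Tendsto (fun x : ℝ => x ^ (m + 1)) (𝓝[≠] 0) (𝓝 0) := by
      have : ContinuousAt (fun x : ℝ => x ^ (m + 1)) 0 := by fun_prop
      simpa using this.tendsto.mono_left nhdsWithin_le_nhds
    have hf0 : f 0 = 0 := by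
      have h1 : Tendsto (fun x => (f x - α * x ^ (m + 1)) + α * x ^ (m + 1)) (𝓝[≠] 0) (𝓝 0) := by
        simpa using (hα.trans_tendsto hpow).add (hpow.const_mul α)
      refine tendsto_nhds_unique (hc.tendsto.mono_left nhdsWithin_le_nhds) (h1.congr ?_)
      intro x; ring
    have hf' : ContDiff ℝ (m + n + 1 : ℕ) f := by
      rwa [show m + n + 1 = m + 1 + n by ring]
    have hmul : ∀ x, f x = x * dslope f 0 x := fun x => by
      rw [eq_add_mul_dslope f x, hf0, zero_add]
    obtain ⟨g, hg, hg0, hfg, hdg⟩ := ih (contDiff_dslope_zero hf') (by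
      rw [isLittleO_iff] at hα ⊢
      intro c hcpos
      filter_upwards [hα hcpos, self_mem_nhdsWithin] with x hx hx0
      have hx0' : 0 < ‖x‖ := norm_pos_iff.2 hx0
      rw [hmul x, show x * dslope f 0 x - α * x ^ (m + 1) = x * (dslope f 0 x - α * x ^ m) by ring,
        pow_succ', norm_mul, norm_mul, mul_left_comm] at hx
      exact le_of_mul_le_mul_left hx hx0')
    refine ⟨g, hg, hg0, fun x => by rw [hmul x, hfg x]; ring, fun hd => hdg ?_⟩
    rw [show m + 1 + n = m + n + 1 by ring] at hd
    exact differentiableAt_iteratedDeriv_dslope hf' hd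

/-- The Leibniz formula for `f g = 1`, solved for the `n`-th derivative of `g`, involves only lower
derivatives of `g` and derivatives of `f` up to order `n`. -/
theorem differentiableAt_iteratedDeriv_of_mul_eq_one {n : ℕ} {f g : ℝ → ℝ}
    (hf : ContDiff ℝ n f) (hg : ContDiff ℝ n g) (hfg : ∀ᶠ x in 𝓝 (0 : ℝ), f x * g x = 1)
    (hd : DifferentiableAt ℝ (iteratedDeriv n f) 0) :
    DifferentiableAt ℝ (iteratedDeriv n g) 0 := by
  have hmul : f * g =ᶠ[𝓝 0] fun _ => (1 : ℝ) := hfg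
  have key : ∀ᶠ x in 𝓝 (0 : ℝ), iteratedDeriv n g x = g x * (iteratedDeriv n (fun _ => (1 : ℝ)) x -
      ∑ i ∈ Finset.range n, (n.choose (i + 1)) * iteratedDeriv (i + 1) f x *
        iteratedDeriv (n - (i + 1)) g x) := by
    filter_upwards [hfg, hmul.iteratedDeriv n] with x hx hx'
    rw [← hx', iteratedDeriv_mul hf.contDiffAt hg.contDiffAt, Finset.sum_range_succ']
    simp only [Nat.choose_zero_right, Nat.cast_one, one_mul, iteratedDeriv_zero, Nat.sub_zero,
      add_sub_cancel_left]
    rw [← mul_assoc, mul_comm (g x), hx, one_mul]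
  have hg0 : DifferentiableAt ℝ g 0 := by
    have hf0 : f 0 ≠ 0 := fun h => by simpa [h] using hfg.self_of_nhds
    have hfd : DifferentiableAt ℝ f 0 := by
      rcases Nat.eq_zero_or_pos n with rfl | hn
      · simpa using hd
      · exact hf.differentiable (by norm_cast; omega) 0
    refine (hfd.inv hf0).congr_of_eventuallyEq ?_
    filter_upwards [hfg] with x hx
    exact eq_inv_of_mul_eq_one_right hx
  refine DifferentiableAt.congr_of_eventuallyEq ?_ key
  refine hg0.mul (DifferentiableAt.sub ?_ (DifferentiableAt.fun_sum fun i hi => ?_))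
  · exact ((contDiff_const (c := (1 : ℝ))).differentiable_iteratedDeriv (n := n + 1) n
      (by norm_cast; omega)) 0
  · rw [Finset.mem_range] at hi
    refine ((differentiableAt_const _).mul ?_).mul ?_
    · rcases (Nat.succ_le_of_lt hi).lt_or_eq with h | h
      · exact hf.differentiable_iteratedDeriv _ (by exact_mod_cast h) 0
      · rwa [show i + 1 = n from h]
    · exact hg.differentiable_iteratedDeriv _ (by norm_cast; omega) 0

/-! ### The singular Euler equation -/

/-- Solution of the singular Euler equation `ℓ G - x G' = Z`, up to the resonant monomial. -/
theorem exists_euler_solution {ℓ n : ℕ} {Z : ℝ → ℝ} (hZ : ContDiff ℝ n Z) (hn : ℓ ≤ n)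
    (hd : DifferentiableAt ℝ (iteratedDeriv ℓ Z) 0) :
    ∃ (μ : ℝ) (G : ℝ → ℝ), Differentiable ℝ G ∧ ContDiff ℝ n G ∧
      ∀ x, ℓ * G x - x * deriv G x = Z x + μ * x ^ ℓ := by
  -- For `m = 0` the truncated `m - 1` is `0`, and continuity of `f` suffices.
  have antideriv : ∀ (m : ℕ) (c : ℝ) (f : ℝ → ℝ), Continuous f → ContDiff ℝ (m - 1 : ℕ) f →
      ∃ G : ℝ → ℝ, Differentiable ℝ G ∧ ContDiff ℝ m G ∧ deriv G = f ∧ G 0 = c := by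
    intro m c f hf hfm
    have hG : ∀ x, HasDerivAt (fun x => c + ∫ t in (0 : ℝ)..x, f t) (f x) x := fun x =>
      (intervalIntegral.integral_hasDerivAt_right (hf.intervalIntegrable _ _)
        (hf.stronglyMeasurableAtFilter _ _) hf.continuousAt).const_add c
    have hGd : Differentiable ℝ (fun x => c + ∫ t in (0 : ℝ)..x, f t) :=
      fun x => (hG x).differentiableAt
    refine ⟨_, hGd, ?_, funext fun x => (hG x).deriv, by simp⟩
    cases m with
    | zero => exact contDiff_zero.2 hGd.continuous
    | succ m =>
      push_cast
      rw [contDiff_succ_iff_deriv, funext fun x => (hG x).deriv]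
      exact ⟨hGd, by simp, hfm⟩
  induction ℓ generalizing n Z with
  | zero =>
    rw [iteratedDeriv_zero] at hd
    -- For `ℓ = 0` the equation is `-x G' = Z + μ`: it forces `μ = -Z 0`, and differentiability of
    -- `Z` at `0` makes the quotient by `x` continuous.
    have hc := continuous_dslope_zero hZ.continuous hd
    obtain ⟨G, hGd, hGn, hG', -⟩ := antideriv n 0 (fun x => -dslope Z 0 x) hc.neg (by
      cases n with
      | zero => exact contDiff_zero.2 hc.neg
      | succ n => exact (contDiff_dslope_zero hZ).neg)
    refine ⟨-Z 0, G, hGd, hGn, fun x => ?_⟩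
    rw [hG', eq_add_mul_dslope Z x]
    simp
  | succ ℓ ih =>
    obtain ⟨n, rfl⟩ : ∃ k, n = k + 1 := ⟨n - 1, by omega⟩
    have hZ1 : Differentiable ℝ Z := hZ.differentiable (by norm_cast)
    rw [iteratedDeriv_succ'] at hd
    obtain ⟨μ, G₁, hG₁d, hG₁n, hG₁⟩ := ih (n := n)
      (by push_cast at hZ; exact (contDiff_succ_iff_deriv.1 hZ).2.2) (by omega) hd
    -- Differentiating the equation lowers `ℓ` by one and replaces `Z` by `Z'`, so `G` is a
    -- primitive of `G₁`; its value at `0` is read off the equation at `x = 0`.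
    obtain ⟨G, hGd, hGn, hG', hG0⟩ := antideriv (n + 1) (Z 0 / (ℓ + 1)) G₁ hG₁n.continuous hG₁n
    have hℓ : (ℓ + 1 : ℝ) ≠ 0 := by positivity
    refine ⟨μ / (ℓ + 1), G, hGd, hGn, fun x => ?_⟩
    have hE : ∀ x, HasDerivAt (fun x => (ℓ + 1) * G x - x * G₁ x - Z x -
        μ / (ℓ + 1) * x ^ (ℓ + 1)) 0 x := fun x => by
      have h1 : HasDerivAt G (G₁ x) x := by simpa [hG'] using (hGd x).hasDerivAt
      have h2 := (hasDerivAt_pow (ℓ + 1) x).const_mul (μ / (ℓ + 1))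
      refine ((((h1.const_mul ((ℓ : ℝ) + 1)).sub
        ((hasDerivAt_id x).mul (hG₁d x).hasDerivAt)).sub (hZ1 x).hasDerivAt).sub h2).congr_deriv ?_
      have := hG₁ x
      have h3 : μ / (ℓ + 1) * (((ℓ + 1 : ℕ) : ℝ) * x ^ (ℓ + 1 - 1)) = μ * x ^ ℓ := by
        rw [Nat.add_sub_cancel]
        push_cast
        field_simp
      rw [h3, id]
      linarith
    have hconst := is_const_of_deriv_eq_zero (fun x => (hE x).differentiableAt)
      (fun x => (hE x).deriv) x 0
    simp only [hG0, zero_mul, sub_zero, ne_eq, Nat.add_eq_zero_iff, one_ne_zero, and_false,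
      not_false_eq_true, zero_pow, mul_zero] at hconst
    rw [mul_div_cancel₀ _ hℓ] at hconst
    rw [hG']
    push_cast
    linarith

/-- The operator `m ↦ ℓ m - x m'` creates no monomial of degree `ℓ` in Taylor expansions. -/
theorem euler_operator_coeff_eq_zero {ℓ : ℕ} (hℓ : 1 ≤ ℓ) {m : ℝ → ℝ} (hm : ContDiff ℝ ℓ m)
    {c q : ℝ} (h : (fun x => ℓ * m x - x * deriv m x - c - q * x ^ ℓ) =o[𝓝[≠] 0]
      fun x : ℝ => x ^ ℓ) : q = 0 := by
  have lim : ∀ {f : ℝ → ℝ}, Continuous f → Tendsto f (𝓝[≠] 0) (𝓝 (f 0)) := fun hf =>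
    hf.continuousAt.tendsto.mono_left nhdsWithin_le_nhds
  have const : ∀ (k : ℕ), 1 ≤ k → ∀ (m : ℝ → ℝ), ContDiff ℝ 1 m → ∀ c,
      (fun x => k * m x - x * deriv m x - c - q * x ^ k) =o[𝓝[≠] 0] (fun x : ℝ => x ^ k) →
      c = k * m 0 := by
    intro k hk m hm c h
    have hc := hm.continuous
    have hc' := hm.continuous_deriv_one
    have hp : Tendsto (fun x : ℝ => x ^ k) (𝓝[≠] 0) (𝓝 0) := by
      simpa [show k ≠ 0 by omega] using lim (continuous_pow k)
    have h1 := h.trans_tendsto hp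
    have h2 := lim (by fun_prop : Continuous fun x => k * m x - x * deriv m x - c - q * x ^ k)
    have := tendsto_nhds_unique h2 h1
    simp only [zero_mul, sub_zero, ne_eq, show k ≠ 0 by omega, not_false_eq_true, zero_pow,
      mul_zero] at this
    linarith
  have div : ∀ {k : ℕ} {f : ℝ → ℝ}, (fun x => x * f x) =o[𝓝[≠] 0] (fun x : ℝ => x ^ (k + 1)) →
      f =o[𝓝[≠] 0] fun x : ℝ => x ^ k := by
    intro k f h
    rw [isLittleO_iff] at h ⊢
    intro ε hε
    filter_upwards [h hε, self_mem_nhdsWithin] with x hx hx0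
    rw [pow_succ', norm_mul, norm_mul, mul_left_comm] at hx
    exact le_of_mul_le_mul_left hx (norm_pos_iff.2 hx0)
  induction ℓ, hℓ using Nat.le_induction generalizing m c with
  | base =>
    have hm1 : ContDiff ℝ 1 m := by simpa using hm
    have hcm := const 1 le_rfl m hm1 c h
    have hc' := hm1.continuous_deriv_one
    have hds := continuous_dslope_zero hm1.continuous (hm1.differentiable one_ne_zero 0)
    -- Both `dslope m 0` and `deriv m` tend to `m'(0)`, so only `q` survives in the limit.
    have h1 : (fun x => dslope m 0 x - deriv m x - q) =o[𝓝[≠] 0] fun x : ℝ => x ^ 0 := by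
      refine div (h.congr_left fun x => ?_)
      rw [hcm, eq_add_mul_dslope m x]
      push_cast
      ring
    have h2 : Tendsto (fun x => dslope m 0 x - deriv m x - q) (𝓝[≠] 0) (𝓝 0) := by
      simpa [isLittleO_one_iff] using h1
    have h3 := lim (by fun_prop : Continuous fun x => dslope m 0 x - deriv m x - q)
    have := tendsto_nhds_unique h3 h2
    simpa using this
  | succ ℓ hℓ ih =>
    have hm1 : ContDiff ℝ 1 m := hm.of_le (by norm_cast; omega)
    have hcm := const (ℓ + 1) (by omega) m hm1 c h
    have hds := contDiff_dslope_zero hm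
    have hdd : Differentiable ℝ (dslope m 0) := hds.differentiable (by norm_cast; omega)
    -- With `m = m(0) + x d`, the operator gives `(ℓ + 1) m(0) + x (ℓ d - x d')`; removing the
    -- constant and dividing by `x` lowers `ℓ`.
    refine ih hds (c := 0) (div (h.congr_left fun x => ?_))
    have hder : HasDerivAt m (dslope m 0 x + x * deriv (dslope m 0) x) x := by
      have : HasDerivAt (fun x => m 0 + x * dslope m 0 x)
          (1 * dslope m 0 x + x * deriv (dslope m 0) x) x :=
        ((hasDerivAt_id x).mul (hdd x).hasDerivAt).const_add _
      rw [one_mul] at this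
      exact this.congr_of_eventuallyEq (Eventually.of_forall fun y => eq_add_mul_dslope m y)
    rw [hder.deriv, hcm, eq_add_mul_dslope m x]
    push_cast
    ring

/-! ### Time functions and the factorization of the field -/

/-- The equation expressing that `x ↦ x * k x` matches the time function of the normal form with a
prescribed time function has a solution `k` as regular as the data. -/
theorem exists_time_solution {ℓ n : ℕ} (hℓ : 1 ≤ ℓ) (hn : 1 ≤ n) (μ : ℝ) {G : ℝ → ℝ}
    (hG : ContDiff ℝ n G) {k₀ : ℝ} (hk₀ : 0 < k₀) (hG0 : G 0 = (k₀ ^ ℓ)⁻¹) :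
    ∃ k : ℝ → ℝ, ContDiffAt ℝ n k 0 ∧ k 0 = k₀ ∧ ∀ᶠ x in 𝓝 (0 : ℝ),
      (k x ^ ℓ)⁻¹ + ℓ * μ * x ^ ℓ * Real.log (k x) -
        μ * x ^ ℓ * Real.log (1 + μ * x ^ ℓ * k x ^ ℓ) = G x := by
  let F : ℝ × ℝ → ℝ := fun p => (p.2 ^ ℓ)⁻¹ + ℓ * μ * p.1 ^ ℓ * Real.log p.2 -
    μ * p.1 ^ ℓ * Real.log (1 + μ * p.1 ^ ℓ * p.2 ^ ℓ) - G p.1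
  have hℓ0 : ℓ ≠ 0 := by omega
  have hn0 : (n : WithTop ℕ∞) ≠ 0 := by norm_cast; omega
  have hF : ContDiffAt ℝ n F (0, k₀) := by
    have h1 : ContDiffAt ℝ n (fun p : ℝ × ℝ => p.1) (0, k₀) := contDiffAt_fst
    have h2 : ContDiffAt ℝ n (fun p : ℝ × ℝ => p.2) (0, k₀) := contDiffAt_snd
    refine ((((h2.pow ℓ).inv (by simp [hk₀.ne'])).add
      ((contDiffAt_const.mul (h1.pow ℓ)).mul (h2.log hk₀.ne'))).sub
      ((contDiffAt_const.mul (h1.pow ℓ)).mul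
        ((contDiffAt_const.add ((contDiffAt_const.mul (h1.pow ℓ)).mul (h2.pow ℓ))).log ?_))).sub
      (hG.contDiffAt.comp _ h1)
    simp [hℓ0]
  have hF0 : F (0, k₀) = 0 := by simp [F, hG0, hℓ0]
  -- At `x = 0` the logarithmic terms vanish because `ℓ ≥ 1`, leaving the derivative of `t^(-ℓ)`.
  have hder : fderiv ℝ F (0, k₀) (0, 1) ≠ 0 := by
    have h1 : HasDerivAt (fun t : ℝ => ((0 : ℝ), t)) ((0 : ℝ), (1 : ℝ)) k₀ :=
      (hasDerivAt_const k₀ (0 : ℝ)).prodMk (hasDerivAt_id k₀)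
    have h2 := (hF.differentiableAt hn0).hasFDerivAt.comp_hasDerivAt k₀ h1
    have h3 : HasDerivAt (fun t : ℝ => (t ^ ℓ)⁻¹ - G 0)
        (-(ℓ * k₀ ^ (ℓ - 1)) / (k₀ ^ ℓ) ^ 2) k₀ :=
      ((hasDerivAt_pow ℓ k₀).inv (by positivity)).sub_const _
    have h4 : (F ∘ fun t : ℝ => ((0 : ℝ), t)) = fun t : ℝ => (t ^ ℓ)⁻¹ - G 0 := by
      funext t
      simp [F, hℓ0]
    rw [h4] at h2
    rw [h2.unique h3]
    have : (0 : ℝ) < ℓ := by exact_mod_cast hℓ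
    exact (div_neg_of_neg_of_pos (neg_neg_of_pos (by positivity)) (by positivity)).ne
  have hinv : (fderiv ℝ F (0, k₀) ∘L .inr ℝ ℝ ℝ).IsInvertible := by
    refine ⟨ContinuousLinearEquiv.unitsEquivAut ℝ (Units.mk0 _ hder), ?_⟩
    ext
    simp
  refine ⟨hF.implicitFunction hn0 hinv, hF.contDiffAt_implicitFunction hn0 hinv,
    hF.implicitFunction_apply_self hn0 hinv, ?_⟩
  filter_upwards [hF.eventually_apply_implicitFunction hn0 hinv] with x hx
  rw [hF0] at hx
  exact sub_eq_zero.1 hx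

/-- An expanding exactly flat field is the product of a monomial and of a positive function whose
inverse satisfies the assumptions of `exists_euler_solution`. -/
theorem exists_eq_pow_mul_unit {ℓ n : ℕ} {X : ℝ → ℝ}
    (hX : ContDiffAt ℝ (ℓ + (n + 1) : ℕ) X 0) (hexp : Expanding X) (hflat : ExactlyFlat ℓ X)
    (hn : ℓ + 2 ≤ n + 1 ∨ (n + 1 = ℓ + 1 ∧ TimesDifferentiableAt (2 * ℓ + 2) X 0)) :
    ∃ Y Z : ℝ → ℝ, ContDiff ℝ n Y ∧ ContDiff ℝ n Z ∧ 0 < Y 0 ∧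
      (∀ᶠ x in 𝓝 0, X x = x ^ (ℓ + 1) * Y x) ∧ (∀ᶠ x in 𝓝 0, Y x * Z x = 1) ∧
      DifferentiableAt ℝ (iteratedDeriv ℓ Z) 0 := by
  obtain ⟨α, hα, hXα⟩ := hflat
  obtain ⟨f, hf, hfX⟩ := exists_contDiff_eventuallyEq hX
  have hf' : ContDiff ℝ (ℓ + 1 + n : ℕ) f := by rwa [show ℓ + 1 + n = ℓ + (n + 1) by ring]
  obtain ⟨Y, hY, hY0, hfY, hYd⟩ := exists_eq_pow_mul (α := α) hf' (by
    refine (hXα.mono nhdsWithin_le_nhds).congr' ?_ EventuallyEq.rfl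
    filter_upwards [nhdsWithin_le_nhds hfX] with x hx
    rw [hx])
  have hXY : ∀ᶠ x in 𝓝 0, X x = x ^ (ℓ + 1) * Y x := by
    filter_upwards [hfX] with x hx
    rw [← hx, hfY x]
  have hYpos : 0 < Y 0 := by
    refine lt_of_le_of_ne ?_ (hY0 ▸ hα.symm)
    refine ge_of_tendsto (hY.continuous.continuousAt.tendsto.mono_left
      (nhdsWithin_le_nhds (s := Set.Ioi 0))) ?_
    filter_upwards [hexp, nhdsWithin_le_nhds hXY, self_mem_nhdsWithin] with x hx hx' hx0
    rw [hx'] at hx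
    exact (pos_of_mul_pos_right hx (pow_nonneg (le_of_lt hx0) _)).le
  obtain ⟨Z, hZ, hZY⟩ := exists_contDiff_eventuallyEq (hY.contDiffAt.inv hYpos.ne')
  have hYZ : ∀ᶠ x in 𝓝 0, Y x * Z x = 1 := by
    filter_upwards [hZY, hY.continuous.continuousAt.eventually_ne hYpos.ne'] with x hx hx'
    rw [hx]
    exact mul_inv_cancel₀ hx'
  refine ⟨Y, Z, hY, hZ, hYpos, hXY, hYZ, ?_⟩
  rcases hn with hn | ⟨hn, hd⟩
  · exact hZ.differentiable_iteratedDeriv ℓ (by norm_cast; omega) 0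
  -- In the borderline case `Z` is only `C^ℓ`; the missing differentiability comes from the
  -- derivative of `X` of order `2ℓ + 1`.
  · obtain rfl : n = ℓ := by omega
    refine differentiableAt_iteratedDeriv_of_mul_eq_one hY hZ hYZ (hYd ?_)
    rw [show n + 1 + n = 2 * n + 1 by ring]
    exact (hd (2 * n + 1) (by omega)).1.congr_of_eventuallyEq (hfX.iteratedDeriv _)

/-! ### Conjugacies: existence and uniqueness -/

theorem isDiffeoGerm_of_deriv_ne_zero {r : ℕ} (hr : 1 ≤ r) {h : ℝ → ℝ} (hh : ContDiffAt ℝ r h 0)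
    (h0 : h 0 = 0) (hd : deriv h 0 ≠ 0) : IsDiffeoGerm r h := by
  have hr0 : (r : WithTop ℕ∞) ≠ 0 := by norm_cast; omega
  let e : ℝ ≃L[ℝ] ℝ := ContinuousLinearEquiv.unitsEquivAut ℝ (Units.mk0 _ hd)
  have he : HasFDerivAt h (e : ℝ →L[ℝ] ℝ) 0 := by
    refine (hh.differentiableAt hr0).hasDerivAt.hasFDerivAt.congr_fderiv ?_
    ext
    simp [e]
  have hs := hh.hasStrictFDerivAt' he hr0
  refine ⟨hh, h0, hs.localInverse h e 0, ?_, ?_, hs.eventually_left_inverse, ?_⟩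
  · have := hh.to_localInverse he hr0
    rw [h0] at this
    exact this
  · simpa [h0] using hs.localInverse_apply_image
  · simpa [h0] using hs.eventually_right_inverse

theorem IsDiffeoGerm.deriv_ne_zero {r : ℕ} (hr : 1 ≤ r) {h : ℝ → ℝ} (hh : IsDiffeoGerm r h) :
    deriv h 0 ≠ 0 := by
  have hr0 : (r : WithTop ℕ∞) ≠ 0 := by norm_cast; omega
  obtain ⟨hh, h0, g, hg, -, hgh, -⟩ := hh
  have h1 := (hh.differentiableAt hr0).hasDerivAt
  have h2 : HasDerivAt g (deriv g 0) (h 0) := by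
    rw [h0]
    exact (hg.differentiableAt hr0).hasDerivAt
  have h3 := (h2.comp 0 h1).congr_of_eventuallyEq (f₁ := fun x => x)
    (hgh.mono fun x hx => hx.symm)
  have := h3.unique (hasDerivAt_id (0 : ℝ))
  intro h4
  simp [h4] at this

/-- The differential equation satisfied by `x * k`, derived from the equation of
`exists_time_solution` and its derivative. -/
theorem deriv_eq_of_time_equation {ℓ : ℕ} (hℓ : 1 ≤ ℓ) {μ x k k' G G' Z Lk Lu : ℝ} (hk : k ≠ 0)
    (hu : 1 + μ * x ^ ℓ * k ^ ℓ ≠ 0)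
    (h' : -(ℓ * k ^ (ℓ - 1) * k') / (k ^ ℓ) ^ 2 +
      (ℓ * μ * (ℓ * x ^ (ℓ - 1)) * Lk + ℓ * μ * x ^ ℓ * (k' / k)) -
      (μ * (ℓ * x ^ (ℓ - 1)) * Lu + μ * x ^ ℓ * ((μ * (ℓ * x ^ (ℓ - 1)) * k ^ ℓ +
        μ * x ^ ℓ * (ℓ * k ^ (ℓ - 1) * k')) / (1 + μ * x ^ ℓ * k ^ ℓ))) = G')
    (hG : ℓ * G - x * G' = ℓ * (Z + μ * x ^ ℓ))
    (h : (k ^ ℓ)⁻¹ + ℓ * μ * x ^ ℓ * Lk - μ * x ^ ℓ * Lu = G) :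
    1 * k + x * k' = Z * k ^ (ℓ + 1) * (1 + μ * x ^ ℓ * k ^ ℓ) := by
  obtain ⟨p, rfl⟩ : ∃ p, ℓ = p + 1 := ⟨ℓ - 1, by omega⟩
  have hp : ((p + 1 : ℕ) : ℝ) ≠ 0 := by positivity
  have hkp : k ^ p ≠ 0 := pow_ne_zero _ hk
  -- The logarithms `Lk` and `Lu` can stay arbitrary: they drop out because the Euler operator kills
  -- their coefficient `x^ℓ`.
  rw [← h, ← h'] at hG
  simp only [Nat.add_sub_cancel, pow_succ] at *
  generalize ((p + 1 : ℕ) : ℝ) = c at *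
  generalize k ^ p = B at *
  generalize x ^ p = A at *
  have hZ : Z = (B * k)⁻¹ + x * k' / (B * k * k) - μ * (A * x) * x * (k' / k) +
      μ * μ * A * x * A * x * B * (k + x * k') / (1 + μ * (A * x) * (B * k)) - μ * (A * x) := by
    refine mul_left_cancel₀ hp ?_
    generalize hv : 1 + μ * (A * x) * (B * k) = v at *
    field_simp at hG ⊢
    linear_combination -hG
  rw [hZ]
  generalize hv : 1 + μ * (A * x) * (B * k) = v at *
  field_simp
  rw [← hv]
  ring

/-- Existence of the conjugacy, in terms of a solution `G` of the Euler equation. -/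
theorem exists_conjugates_normalForm {ℓ n : ℕ} (hℓ : 1 ≤ ℓ) (hn : 1 ≤ n) {X Y Z G : ℝ → ℝ} {μ : ℝ}
    (hZ : ContDiff ℝ n Z) (hY0 : 0 < Y 0)
    (hXY : ∀ᶠ x in 𝓝 0, X x = x ^ (ℓ + 1) * Y x) (hYZ : ∀ᶠ x in 𝓝 0, Y x * Z x = 1)
    (hG : ContDiff ℝ n G)
    (hGZ : ∀ x, ℓ * G x - x * deriv G x = ℓ * (Z x + μ * x ^ ℓ)) :
    ∃ h : ℝ → ℝ, IsDiffeoGerm (n + 1) h ∧ 0 < deriv h 0 ∧ Conjugates h X (normalForm ℓ μ) := by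
  have hℓ0 : ℓ ≠ 0 := by omega
  have hℓ' : (ℓ : ℝ) ≠ 0 := by exact_mod_cast hℓ0
  have hn0 : (n : WithTop ℕ∞) ≠ 0 := by norm_cast; omega
  have hZ0 : Y 0 * Z 0 = 1 := hYZ.self_of_nhds
  have hG0 : G 0 = Z 0 := by
    have := hGZ 0
    simpa [hℓ0] using this
  obtain ⟨k₀, hk₀, hk₀Y⟩ : ∃ k₀ : ℝ, 0 < k₀ ∧ k₀ ^ ℓ = Y 0 :=
    ⟨Y 0 ^ ((ℓ : ℝ)⁻¹), Real.rpow_pos_of_pos hY0 _, Real.rpow_inv_natCast_pow hY0.le hℓ0⟩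
  obtain ⟨k, hk, hk0, hkG⟩ := exists_time_solution hℓ hn μ hG hk₀ (by
    rw [hG0, hk₀Y]
    exact eq_inv_of_mul_eq_one_right hZ0)
  have hk1 : ∀ᶠ x in 𝓝 (0 : ℝ), DifferentiableAt ℝ k x := by
    filter_upwards [hk.eventually (by simp)] with x hx using hx.differentiableAt hn0
  have hkpos : ∀ᶠ x in 𝓝 (0 : ℝ), 0 < k x :=
    hk.continuousAt.eventually_const_lt (by rwa [hk0])
  have hupos : ∀ᶠ x in 𝓝 (0 : ℝ), 0 < 1 + μ * x ^ ℓ * k x ^ ℓ := by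
    have hkc := hk.continuousAt
    have : ContinuousAt (fun x => 1 + μ * x ^ ℓ * k x ^ ℓ) 0 := by fun_prop
    exact this.eventually_const_lt (by simp [hℓ0])
  have hder : ∀ᶠ x in 𝓝 (0 : ℝ), HasDerivAt (fun x => x * k x)
      (Z x * k x ^ (ℓ + 1) * (1 + μ * x ^ ℓ * k x ^ ℓ)) x := by
    filter_upwards [hk1, hkpos, hupos, hkG.eventually_nhds] with x hk1 hkpos hupos hkG
    have hd := hk1.hasDerivAt
    have hpow := hasDerivAt_pow ℓ x
    have hkpow := hd.pow ℓ
    have hlog := hd.log hkpos.ne'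
    have hu := ((hpow.const_mul μ).mul hkpow).const_add 1
    have hul := hu.log hupos.ne'
    have hL := ((hkpow.inv (pow_pos hkpos _).ne').add ((hpow.const_mul (ℓ * μ)).mul hlog)).sub
      ((hpow.const_mul μ).mul hul)
    have hGd := (hG.differentiable hn0 x).hasDerivAt
    have heq := hL.unique (hGd.congr_of_eventuallyEq hkG)
    have hG1 := hGZ x
    have hG2 := hkG.self_of_nhds
    refine ((hasDerivAt_id x).mul hd).congr_deriv ?_
    exact deriv_eq_of_time_equation hℓ hkpos.ne' hupos.ne' heq hG1 hG2
  have hd0 : deriv (fun x => x * k x) 0 = k₀ := by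
    rw [hder.self_of_nhds.deriv, hk0, pow_succ, hk₀Y]
    simp only [ne_eq, hℓ0, not_false_eq_true, zero_pow, mul_zero, zero_mul, add_zero, mul_one]
    rw [← mul_assoc, mul_comm (Z 0), hZ0, one_mul]
  -- One derivative is gained here: `k` is only `C^n`, but so is the formula for the derivative of
  -- `x k`.
  have hC : ContDiffAt ℝ (n + 1 : ℕ) (fun x => x * k x) 0 := by
    push_cast
    rw [contDiffAt_succ_iff_hasFDerivAt]
    refine ⟨fun x => ContinuousLinearMap.toSpanSingleton ℝ
      (Z x * k x ^ (ℓ + 1) * (1 + μ * x ^ ℓ * k x ^ ℓ)), ⟨_, hder, fun x hx => hx.hasFDerivAt⟩, ?_⟩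
    have hZ' := hZ.contDiffAt (x := 0)
    have : ContDiffAt ℝ n (fun x => Z x * k x ^ (ℓ + 1) * (1 + μ * x ^ ℓ * k x ^ ℓ)) 0 := by
      fun_prop
    exact (ContinuousLinearMap.toSpanSingletonCLE (𝕜 := ℝ) (E := ℝ)).contDiff.contDiffAt.comp 0 this
  refine ⟨fun x => x * k x, isDiffeoGerm_of_deriv_ne_zero (by omega) hC (by simp)
    (by rw [hd0]; exact hk₀.ne'), by rwa [hd0], ?_⟩
  filter_upwards [hder, hXY, hYZ] with x hx hXx hYZx
  rw [hx.deriv, hXx, normalForm]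
  linear_combination (x * k x) ^ (ℓ + 1) * (1 + μ * x ^ ℓ * k x ^ ℓ) * hYZx

/-- The coefficient of the resonant monomial of a normal form conjugate to `X` is determined by the
Euler equation attached to `X`. -/
theorem eq_of_conjugates_normalForm {ℓ n : ℕ} (hℓ : 1 ≤ ℓ) (hn : ℓ ≤ n) {X Y Z G h : ℝ → ℝ}
    {μ ν : ℝ} (hZ : ContDiff ℝ n Z)
    (hXY : ∀ᶠ x in 𝓝 0, X x = x ^ (ℓ + 1) * Y x) (hYZ : ∀ᶠ x in 𝓝 0, Y x * Z x = 1)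
    (hG : ContDiff ℝ n G) (hGZ : ∀ x, ℓ * G x - x * deriv G x = ℓ * (Z x + μ * x ^ ℓ))
    (hh : IsDiffeoGerm (n + 1) h) (hconj : Conjugates h X (normalForm ℓ ν)) : ν = μ := by
  have hℓ0 : ℓ ≠ 0 := by omega
  have hℓ' : (ℓ : ℝ) ≠ 0 := by exact_mod_cast hℓ0
  have hn0 : (n : WithTop ℕ∞) ≠ 0 := by norm_cast; omega
  have lim : ∀ {f : ℝ → ℝ}, Continuous f → Tendsto f (𝓝[≠] 0) (𝓝 (f 0)) := fun hf =>
    hf.continuousAt.tendsto.mono_left nhdsWithin_le_nhds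
  obtain ⟨H, hH, hHh⟩ := exists_contDiff_eventuallyEq hh.1
  have hH1 : ContDiff ℝ 1 H := hH.of_le (by norm_cast; omega)
  have hH0 : H 0 = 0 := by rw [hHh.self_of_nhds, hh.2.1]
  set k := dslope H 0 with hk_def
  have hk : ContDiff ℝ n k := contDiff_dslope_zero hH
  have hHk : ∀ x, H x = x * k x := fun x => by rw [eq_add_mul_dslope H x, hH0, zero_add]
  have hkd : Differentiable ℝ k := hk.differentiable hn0
  have hH' : ∀ x, deriv H x = k x + x * deriv k x := fun x => by
    have : HasDerivAt (fun x => x * k x) (1 * k x + x * deriv k x) x :=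
      (hasDerivAt_id x).mul (hkd x).hasDerivAt
    rw [funext hHk, this.deriv, one_mul]
  have hk0 : k 0 ≠ 0 := by
    rw [hk_def, dslope_same, hHh.deriv_eq]
    exact hh.deriv_ne_zero (by omega)
  have hode : ∀ᶠ x in 𝓝[≠] 0,
      deriv H x = k x ^ (ℓ + 1) * (1 + ν * x ^ ℓ * k x ^ ℓ) * Z x := by
    filter_upwards [nhdsWithin_le_nhds hXY, nhdsWithin_le_nhds hYZ, nhdsWithin_le_nhds hconj,
      nhdsWithin_le_nhds hHh.eventuallyEq_nhds, self_mem_nhdsWithin] with x hX hY hc hHh hx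
    have hx' : x ^ (ℓ + 1) ≠ 0 := pow_ne_zero _ hx
    rw [← hHh.deriv_eq, ← hHh.eq_of_nhds, hHk, hX, normalForm] at hc
    refine mul_left_cancel₀ hx' ?_
    linear_combination Z x * hc - x ^ (ℓ + 1) * deriv H x * hY
  have hc1 := hk.continuous
  have hc2 := hZ.continuous
  have hkZ : k 0 ^ ℓ * Z 0 = 1 := by
    have h1 := tendsto_nhds_unique (lim hH1.continuous_deriv_one)
      ((lim (by fun_prop : Continuous fun x =>
        k x ^ (ℓ + 1) * (1 + ν * x ^ ℓ * k x ^ ℓ) * Z x)).congr' (hode.mono fun x hx => hx.symm))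
    simp only [hH', zero_mul, add_zero, ne_eq, hℓ0, not_false_eq_true, zero_pow, mul_zero,
      mul_one] at h1
    refine mul_left_cancel₀ hk0 ?_
    linear_combination -h1
  -- `m = k^(-ℓ)` linearizes the equation: `ℓ m - x m' = ℓ (Z + ν x^ℓ k^ℓ Z)`, where `k^ℓ Z` tends
  -- to `1`.
  obtain ⟨m, hm, hmk⟩ := exists_contDiff_eventuallyEq
    ((hk.pow ℓ).contDiffAt.inv (pow_ne_zero ℓ hk0))
  have key : ∀ᶠ x in 𝓝[≠] 0, ℓ * (G x - m x) - x * deriv (fun x => G x - m x) x - 0 -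
      ℓ * (μ - ν) * x ^ ℓ = (ℓ * ν * (1 - k x ^ ℓ * Z x)) * x ^ ℓ := by
    filter_upwards [hode, nhdsWithin_le_nhds hmk.eventuallyEq_nhds, self_mem_nhdsWithin,
      nhdsWithin_le_nhds (hc1.continuousAt.eventually_ne hk0)] with x hx hmk hx0 hkx
    have hd := (hkd x).hasDerivAt.pow ℓ |>.inv (pow_ne_zero ℓ hkx)
    have hmd : deriv m x = _ := hmk.deriv_eq.trans hd.deriv
    have hmx : m x = (k x ^ ℓ)⁻¹ := hmk.eq_of_nhds
    have hGx := hGZ x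
    rw [hH'] at hx
    have hm' : ℓ * m x - x * deriv m x = ℓ * (1 + ν * x ^ ℓ * k x ^ ℓ) * Z x := by
      rw [hmx, hmd]
      obtain ⟨p, hp⟩ : ∃ p, ℓ = p + 1 := ⟨ℓ - 1, by omega⟩
      have hxk : x * deriv k x = k x ^ (ℓ + 1) * (1 + ν * x ^ ℓ * k x ^ ℓ) * Z x - k x := by
        linear_combination hx
      have e1 : -(ℓ * k x ^ (ℓ - 1) * deriv k x) / (k x ^ ℓ) ^ 2 =
          -(ℓ * deriv k x) / k x ^ (ℓ + 1) := by
        rw [hp, Nat.add_sub_cancel]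
        field_simp
        ring
      rw [Pi.pow_apply, e1, show x * (-(ℓ * deriv k x) / k x ^ (ℓ + 1)) =
        -(ℓ * (x * deriv k x) / k x ^ (ℓ + 1)) by ring, hxk]
      field_simp
      ring
    rw [deriv_fun_sub (hG.differentiable hn0 x) (hm.differentiable hn0 x)]
    linear_combination hGx - hm'
  have hq := euler_operator_coeff_eq_zero (c := 0) (q := ℓ * (μ - ν)) hℓ
    ((hG.sub hm).of_le (by exact_mod_cast hn)) (by
      refine IsLittleO.congr' (f₁ := fun x => (ℓ * ν * (1 - k x ^ ℓ * Z x)) * x ^ ℓ) ?_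
        (key.mono fun x hx => hx.symm) EventuallyEq.rfl
      have h1 : Tendsto (fun x => ℓ * ν * (1 - k x ^ ℓ * Z x)) (𝓝[≠] 0) (𝓝 0) := by
        have := lim (by fun_prop : Continuous fun x => ℓ * ν * (1 - k x ^ ℓ * Z x))
        simpa [hkZ] using this
      simpa using ((isLittleO_one_iff ℝ).2 h1).mul_isBigO (isBigO_refl (fun x : ℝ => x ^ ℓ) _))
  have := (mul_eq_zero.1 hq).resolve_left hℓ'
  linarith

end FlatVectorField

theorem propositionp (ℓ r : ℕ) (hℓ : 1 ≤ ℓ) (X : ℝ → ℝ)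
    (hX : ContDiffAt ℝ ((ℓ + r : ℕ) : WithTop ℕ∞) X 0)
    (hexp : FlatVectorField.Expanding X)
    (hflat : FlatVectorField.ExactlyFlat ℓ X)
    (hr : ℓ + 2 ≤ r ∨
      (r = ℓ + 1 ∧ FlatVectorField.TimesDifferentiableAt (2 * ℓ + 2) X 0)) :
    ∃ μ : ℝ,
      (∃ h : ℝ → ℝ, FlatVectorField.IsDiffeoGerm r h ∧ 0 < deriv h 0 ∧
        FlatVectorField.Conjugates h X (FlatVectorField.normalForm ℓ μ)) ∧
      ∀ (ν : ℝ) (h : ℝ → ℝ), FlatVectorField.IsDiffeoGerm r h →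
        FlatVectorField.Conjugates h X (FlatVectorField.normalForm ℓ ν) → ν = μ := by
  obtain ⟨n, rfl⟩ : ∃ n, r = n + 1 := ⟨r - 1, by omega⟩
  have hℓn : ℓ ≤ n := by omega
  obtain ⟨Y, Z, -, hZ, hY0, hXY, hYZ, hZd⟩ :=
    FlatVectorField.exists_eq_pow_mul_unit hX hexp hflat hr
  obtain ⟨μ, G, -, hG, hGZ⟩ := FlatVectorField.exists_euler_solution hZ hℓn hZd
  -- Scaling by `ℓ` normalizes the solution to take the value `Z 0` at `0`, as matching with
  -- `k^(-ℓ)` requires.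
  have hℓG : ContDiff ℝ n fun x => ℓ * G x := contDiff_const.mul hG
  have hℓGZ : ∀ x, ℓ * (ℓ * G x) - x * deriv (fun x => ℓ * G x) x = ℓ * (Z x + μ * x ^ ℓ) := by
    intro x
    rw [deriv_const_mul _ (hG.differentiable (by norm_cast; omega) x), ← hGZ x]
    ring
  exact ⟨μ, FlatVectorField.exists_conjugates_normalForm hℓ (by omega) hZ hY0 hXY hYZ hℓG hℓGZ,
    fun ν h hh hconj =>
      FlatVectorField.eq_of_conjugates_normalForm hℓ hℓn hZ hXY hYZ hℓG hℓGZ hh hconj⟩
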